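/- Let $G$ be a finite weighted graph, possibly with loops, i.e. let $A=(a_{x,y})$ be a real symmetric matrix indexed by the finite vertex set of $G$, where $a_{x,y}$ is the weight of the edge $xy$ and $a_{x,y}=0$ means that there is no such edge. For an eigenvalue $\theta$ of $A$, let $E_\theta$ be the orthogonal projection onto its eigenspace, and for a vertex $x$ let $e_x$ be its characteristic vector and $\Phi_x=\{\theta : E_\theta e_x\neq 0\}$ its eigenvalue support. Let $i\neq j$ be strongly cospectral vertices of $G$, i.e. $E_\theta e_i=\pm E_\theta e_j$ (with a sign that may depend on $\theta$) for every eigenvalue $\theta$ of $A$; $i$ and $j$ may be joined by an edge, of weight $a_{i,j}$. Let $i_1,\dots,i_u$ be distinct neighbours of $i$ and $j_1,\dots,j_v$ distinct neighbours of $j$ (the two sets may intersect) such that every path from $i$ to $j$, except for the trivial path consisting of the edge $ij$, leaves $i$ through one of $i_1,\dots,i_u$ (its second vertex) and enters $j$ through one of $j_1,\dots,j_v$ (its last vertex before $j$). Then $\Phi_i$ has at least two elements, and the minimum distance between distinct elements of $\Phi_i$ is at most \[|a_{i,j}|+\sqrt{a_{i,j}^2+2\sqrt{\Big(\sum_{k=1}^u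 a_{i,i_k}^2\Big)\Big(\sum_{\ell=1}^v a_{j_\ell,j}^2\Big)}}.\] (In particular, when $a_{i,j}\ge 0$ the first term is $a_{i,j}$.) -/

import Mathlib

/-- A weighted graph on the vertex set `V`, with or without loops, given by its weighted adjacency
matrix: a real symmetric matrix whose entry at `(u, v)` is the weight of the edge `uv`, and is `0`
exactly when there is no such edge (diagonal entries are the weights of the loops). -/
structure WeightedGraph (V : Type*) where
  /-- The weighted adjacency matrix. -/
  adjMatrix : Matrix V V ℝ
  isSymm : adjMatrix.IsSymm

namespace WeightedGraph

variable {V : Type*} (G : WeightedGraph V)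

/-- The underlying simple graph: distinct vertices joined by an edge of nonzero weight. -/
def toSimpleGraph : SimpleGraph V where
  Adj u v := u ≠ v ∧ G.adjMatrix u v ≠ 0
  symm := ⟨fun u v h => ⟨h.1.symm, by rw [G.isSymm.apply u v]; exact h.2⟩⟩
  loopless := ⟨fun _ h => h.1 rfl⟩

variable [Fintype V] [DecidableEq V]

/-- The eigenspace of the weighted adjacency matrix at `θ` (zero if `θ` is not an eigenvalue). -/
noncomputable def eigenspace (θ : ℝ) : Submodule ℝ (EuclideanSpace ℝ V) :=
  Module.End.eigenspace (Matrix.toEuclideanLin G.adjMatrix) θ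

/-- `E_θ`, the orthogonal projection onto the eigenspace at `θ`. -/
noncomputable def eigenprojector (θ : ℝ) : EuclideanSpace ℝ V →L[ℝ] EuclideanSpace ℝ V :=
  (G.eigenspace θ).starProjection

/-- The set of eigenvalues of the weighted adjacency matrix. -/
def eigenvalues : Set ℝ :=
  {θ | Module.End.HasEigenvalue (Matrix.toEuclideanLin G.adjMatrix) θ}

/-- The eigenvalue support `Φ_i` of the vertex `i`: the eigenvalues `θ` with `E_θ e_i ≠ 0`. -/
def eigenvalueSupport (i : V) : Set ℝ :=
  {θ | θ ∈ G.eigenvalues ∧ G.eigenprojector θ (EuclideanSpace.single i 1) ≠ 0}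

/-- `i` and `j` are strongly cospectral: `E_θ e_i = ± E_θ e_j` for every eigenvalue `θ`. -/
def StronglyCospectral (i j : V) : Prop :=
  ∀ θ ∈ G.eigenvalues,
    G.eigenprojector θ (EuclideanSpace.single i 1)
        = G.eigenprojector θ (EuclideanSpace.single j 1) ∨
      G.eigenprojector θ (EuclideanSpace.single i 1)
        = -G.eigenprojector θ (EuclideanSpace.single j 1)

end WeightedGraph

/-- The set of distances between distinct elements of a set of real numbers. -/
def pairwiseDistances (S : Set ℝ) : Set ℝ :=
  {d | ∃ θ ∈ S, ∃ μ ∈ S, θ ≠ μ ∧ d = |θ - μ|}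

/-! Compare two estimates of the Frobenius norm of the commutator of `A` with a diagonal matrix `X`,
where `x i = 1` and `x j = -1`. Below (`two_mul_sq_gap_le_sum_sq_commutator`): strong cospectrality
prevents `e_i + e_j` and `e_i - e_j` from meeting a common eigenvalue, so pairs of eigenvalues met
by one and the other are at least the minimum distance `d` apart. In an eigenbasis the commutator
multiplies each entry of `X` by an eigenvalue difference, and testing against `e_i e_iᵀ - e_j e_jᵀ`
gives `2 d ^ 2`. Above (`sum_sq_commutator_le`): let `X` be constant, equal to `r`, between `i` and
`j`. Only the edge `ij` and the edges into `I` and `J` can contribute, and `r` is then chosen to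
balance the two sides. -/

/-! ### Spectral lower bound for the commutator. -/

open Matrix in
/-- If a diagonal matrix takes the values `1` at `i` and `-1` at `j`, and the eigenvalues met by
`e_i + e_j` are at distance at least `δ` from those met by `e_i - e_j`, then the Frobenius norm of
its commutator with `A` is at least `√2 δ`. -/
theorem two_mul_sq_gap_le_sum_sq_commutator {V : Type*} [Fintype V] [DecidableEq V]
    {A U : Matrix V V ℝ} {l x : V → ℝ} {i j : V} (hij : i ≠ j)
    (hU : U * Uᵀ = 1) (hA : A * U = U * diagonal l) (hAs : A.IsSymm)
    (hxi : x i = 1) (hxj : x j = -1) {δ : ℝ} (hδ : 0 < δ)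
    (hgap : ∀ k m, U i k + U j k ≠ 0 → U i m - U j m ≠ 0 → δ ≤ |l k - l m|) :
    2 * δ ^ 2 ≤ ∑ u, ∑ v, (A u v * (x v - x u)) ^ 2 := by
  have hU' : Uᵀ * U = 1 := mul_eq_one_comm.mp hU
  set W := Uᵀ * diagonal x * U with hW
  set Y := A * diagonal x - diagonal x * A with hY
  set Z := Uᵀ * Y * U with hZ
  have hUA : Uᵀ * A = diagonal l * Uᵀ := by
    have := congrArg transpose hA
    simpa [transpose_mul, hAs.eq] using this
  have hZW : Z = diagonal l * W - W * diagonal l := by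
    simp only [hZ, hY, hW, Matrix.mul_sub, Matrix.sub_mul]
    congr 1
    · rw [← Matrix.mul_assoc Uᵀ A, hUA]; simp only [Matrix.mul_assoc]
    · simp only [Matrix.mul_assoc, hA]
  have hZe : ∀ k m, Z k m = (l k - l m) * W k m := by
    intro k m
    rw [hZW, Matrix.sub_apply, diagonal_mul, mul_diagonal]; ring
  have hYe : ∀ u v, Y u v = A u v * (x v - x u) := by
    intro u v
    rw [hY, Matrix.sub_apply, diagonal_mul, mul_diagonal]; ring
  have hfrob : ∀ M : Matrix V V ℝ, ∑ u, ∑ v, M u v ^ 2 = (Mᵀ * M).trace := by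
    intro M
    rw [Finset.sum_comm]
    simp [trace, Matrix.mul_apply, sq]
  have hZY : ∑ k, ∑ m, Z k m ^ 2 = ∑ u, ∑ v, Y u v ^ 2 := by
    rw [hfrob, hfrob]
    have : Zᵀ * Z = Uᵀ * (Yᵀ * Y * U) := by
      simp only [hZ, transpose_mul, transpose_transpose]
      calc _ = Uᵀ * Yᵀ * (U * Uᵀ) * Y * U := by simp only [Matrix.mul_assoc]
        _ = _ := by rw [hU]; simp only [Matrix.mul_assoc, Matrix.one_mul]
    rw [this, trace_mul_comm, Matrix.mul_assoc, hU, Matrix.mul_one]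
  have hWX : U * W * Uᵀ = diagonal x := by
    calc _ = (U * Uᵀ) * diagonal x * (U * Uᵀ) := by simp only [hW, Matrix.mul_assoc]
      _ = _ := by rw [hU]; simp
  have hWXe : ∀ u v, ∑ k, ∑ m, U u k * U v m * W k m = diagonal x u v := by
    intro u v
    rw [← hWX, Finset.sum_comm, Matrix.mul_apply]
    refine Finset.sum_congr rfl fun m _ => ?_
    rw [Matrix.mul_apply, Finset.sum_mul]
    refine Finset.sum_congr rfl fun k _ => ?_
    rw [transpose_apply]; ring
  have hUe : ∀ u v, ∑ k, U u k * U v k = (1 : Matrix V V ℝ) u v := by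
    intro u v
    rw [← hU, Matrix.mul_apply]; rfl
  set α : V → ℝ := fun k => U i k + U j k with hα
  set β : V → ℝ := fun k => U i k - U j k with hβ
  -- With `k = m` the gap hypothesis would read `δ ≤ 0`.
  have hαβ : ∀ k, α k * β k = 0 := by
    intro k
    by_contra h
    have := hgap k k (left_ne_zero_of_mul h) (right_ne_zero_of_mul h)
    simp at this
    linarith
  have hα2 : ∑ k, α k ^ 2 = 2 := by
    have h1 := hUe i i
    have h2 := hUe i j
    have h3 := hUe j j
    rw [one_apply_eq] at h1 h3
    rw [one_apply_ne hij] at h2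
    have : ∀ k, α k ^ 2 = U i k * U i k + 2 * (U i k * U j k) + U j k * U j k := fun k => by
      simp only [hα]; ring
    simp only [this, Finset.sum_add_distrib, ← Finset.mul_sum, h1, h2, h3]; norm_num
  have hβ2 : ∑ k, β k ^ 2 = 2 := by
    have h1 := hUe i i
    have h2 := hUe i j
    have h3 := hUe j j
    rw [one_apply_eq] at h1 h3
    rw [one_apply_ne hij] at h2
    have : ∀ k, β k ^ 2 = U i k * U i k - 2 * (U i k * U j k) + U j k * U j k := fun k => by
      simp only [hβ]; ring
    simp only [this, Finset.sum_add_distrib, Finset.sum_sub_distrib, ← Finset.mul_sum, h1, h2, h3]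
    norm_num
  -- This is `2 (e_i e_iᵀ - e_j e_jᵀ)` in the eigenbasis, so it pairs with `W` to `2 (x i - x j) =
  -- 4`; it vanishes wherever the gap is not controlled.
  set N : V → V → ℝ := fun k m => α k * β m + α m * β k with hN
  have hNW : ∑ k, ∑ m, N k m * W k m = 4 := by
    have : ∀ k m, N k m * W k m
        = 2 * (U i k * U i m * W k m) - 2 * (U j k * U j m * W k m) := fun k m => by
      simp only [hN, hα, hβ]; ring
    simp only [this, Finset.sum_sub_distrib, ← Finset.mul_sum, hWXe, diagonal_apply_eq, hxi, hxj]
    norm_num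
  have hN2 : ∑ k, ∑ m, N k m ^ 2 = 8 := by
    have : ∀ k m, N k m ^ 2 = α k ^ 2 * β m ^ 2 + β k ^ 2 * α m ^ 2 := fun k m => by
      have h1 := hαβ k
      simp only [hN]
      linear_combination 2 * (α m * β m) * h1
    simp only [this, Finset.sum_add_distrib, ← Finset.mul_sum, ← Finset.sum_mul, hα2, hβ2]
    norm_num
  have hNZ : ∀ k m, δ * (N k m * W k m) ≤ |N k m| * |Z k m| := by
    intro k m
    rw [hZe, abs_mul]
    rcases eq_or_ne (N k m) 0 with h0 | h0
    · simp [h0]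
    have hg : δ ≤ |l k - l m| := by
      by_cases h1 : α k * β m = 0
      · have h2 : α m * β k ≠ 0 := fun h2 => h0 (by simp only [hN, h1, h2, add_zero])
        rw [abs_sub_comm]
        exact hgap m k (left_ne_zero_of_mul h2) (right_ne_zero_of_mul h2)
      · exact hgap k m (left_ne_zero_of_mul h1) (right_ne_zero_of_mul h1)
    calc δ * (N k m * W k m) ≤ δ * |N k m * W k m| := by gcongr; exact le_abs_self _
      _ = |N k m| * (δ * |W k m|) := by rw [abs_mul]; ring
      _ ≤ _ := by gcongr
  have h4 : 4 * δ ≤ ∑ p : V × V, |N p.1 p.2| * |Z p.1 p.2| := by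
    rw [← hNW, mul_comm, Fintype.sum_prod_type, Finset.mul_sum]
    refine Finset.sum_le_sum fun k _ => ?_
    rw [Finset.mul_sum]
    exact Finset.sum_le_sum fun m _ => hNZ k m
  have hcs := Finset.sum_mul_sq_le_sq_mul_sq (Finset.univ : Finset (V × V))
    (fun p => |N p.1 p.2|) (fun p => |Z p.1 p.2|)
  simp only [sq_abs] at hcs
  rw [Fintype.sum_prod_type (fun p : V × V => N p.1 p.2 ^ 2),
    Fintype.sum_prod_type (fun p : V × V => Z p.1 p.2 ^ 2), hN2, hZY] at hcs
  have h16 := pow_le_pow_left₀ (by positivity : 0 ≤ 4 * δ) h4 2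
  simp only [hYe] at hcs
  -- Cauchy–Schwarz now reads `(4 δ) ^ 2 ≤ 8 ‖Y‖ ^ 2`.
  nlinarith

/-! ### Separation by `i` and `j`, and the upper bound. -/

namespace WeightedGraph
open SimpleGraph

variable {V : Type*}

/-- `v` can be joined to `b` by a walk that avoids `a`. -/
def ReachesAvoiding (G : WeightedGraph V) (a b v : V) : Prop :=
  ∃ p : G.toSimpleGraph.Walk v b, a ∉ p.support

theorem not_reachesAvoiding_self (G : WeightedGraph V) (a b : V) :
    ¬ G.ReachesAvoiding a b a := fun ⟨p, hp⟩ => hp p.start_mem_support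

theorem reachesAvoiding_target (G : WeightedGraph V) {a b : V} (h : a ≠ b) :
    G.ReachesAvoiding a b b := ⟨.nil, by simpa using h⟩

theorem ReachesAvoiding.of_adj {G : WeightedGraph V} {a b u v : V}
    (hv : G.ReachesAvoiding a b v) (hu : u ≠ a) (huv : G.toSimpleGraph.Adj u v) :
    G.ReachesAvoiding a b u := by
  obtain ⟨p, hp⟩ := hv
  exact ⟨.cons huv p, by simpa using ⟨hu.symm, hp⟩⟩

theorem reachesAvoiding_congr {G : WeightedGraph V} {a b u v : V} (hu : u ≠ a) (hv : v ≠ a)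
    (huv : G.toSimpleGraph.Adj u v) :
    G.ReachesAvoiding a b u ↔ G.ReachesAvoiding a b v :=
  ⟨fun h => h.of_adj hv huv.symm, fun h => h.of_adj hu huv⟩

theorem ReachesAvoiding.exists_isPath {G : WeightedGraph V} {a b v : V}
    (hv : G.ReachesAvoiding a b v) (hvb : v ≠ b) (hav : G.toSimpleGraph.Adj a v) :
    ∃ p : G.toSimpleGraph.Walk a b, p.IsPath ∧ p.length ≠ 1 ∧ p.snd = v := by
  classical
  obtain ⟨p, hp⟩ := hv
  refine ⟨.cons hav p.bypass, ?_, ?_, by simp⟩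
  · rw [Walk.cons_isPath_iff]
    exact ⟨p.bypass_isPath, fun h => hp (p.support_bypass_subset_support h)⟩
  · intro h
    have : p.bypass.length = 0 := by simpa using h
    exact hvb (Walk.eq_of_length_eq_zero this)

open Classical in
/-- The function equal to `1` at the vertices that `i` separates from `j`, to `-1` at those that
`j` separates from `i`, and to `r` at the remaining vertices. -/
noncomputable def sideFunction (G : WeightedGraph V) (i j : V) (r : ℝ) (v : V) : ℝ :=
  if ¬ G.ReachesAvoiding i j v then 1 else if ¬ G.ReachesAvoiding j i v then -1 else r

theorem sideFunction_left (G : WeightedGraph V) (i j : V) (r : ℝ) :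
    G.sideFunction i j r i = 1 := if_pos (G.not_reachesAvoiding_self i j)

theorem sideFunction_right (G : WeightedGraph V) {i j : V} (hij : i ≠ j) (r : ℝ) :
    G.sideFunction i j r j = -1 := by
  rw [sideFunction, if_neg (not_not.mpr (G.reachesAvoiding_target hij)),
    if_pos (G.not_reachesAvoiding_self j i)]

theorem adj_of_adjMatrix_ne_zero {G : WeightedGraph V} {u v : V} (h : u ≠ v)
    (h0 : G.adjMatrix u v ≠ 0) : G.toSimpleGraph.Adj u v := ⟨h, h0⟩

variable [DecidableEq V]

/-- The contribution to the squared Frobenius norm of the edges leaving `i` or `j`. -/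
noncomputable def cutWeight (G : WeightedGraph V) (i j : V) (I J : Finset V) (r : ℝ)
    (u v : V) : ℝ :=
  (if u = i then (if v ∈ I then (1 - r) ^ 2 * G.adjMatrix i v ^ 2 else 0) else 0) +
  (if u = j then (if v ∈ J then (1 + r) ^ 2 * G.adjMatrix v j ^ 2 else 0) else 0) +
  (if u = i then (if v = j then 4 * G.adjMatrix i j ^ 2 else 0) else 0)

theorem cutWeight_nonneg (G : WeightedGraph V) (i j : V) (I J : Finset V) (r : ℝ) (u v : V) :
    0 ≤ G.cutWeight i j I J r u v := by
  unfold cutWeight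
  positivity

theorem sum_cutWeight [Fintype V] (G : WeightedGraph V) (i j : V) (I J : Finset V) (r : ℝ) :
    ∑ u, ∑ v, G.cutWeight i j I J r u v = (1 - r) ^ 2 * ∑ x ∈ I, G.adjMatrix i x ^ 2 +
      (1 + r) ^ 2 * ∑ y ∈ J, G.adjMatrix y j ^ 2 + 4 * G.adjMatrix i j ^ 2 := by
  have h : ∀ (c : V) (f : V → ℝ), ∑ u, ∑ v, (if u = c then f v else 0) = ∑ v, f v := by
    intro c f
    rw [Finset.sum_comm]
    simp
  simp only [cutWeight, Finset.sum_add_distrib, h, Finset.sum_ite_mem, Finset.univ_inter,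
    Finset.mul_sum, Finset.sum_ite_eq', Finset.mem_univ, if_true]

section cut

variable {G : WeightedGraph V} {i j : V} {I J : Finset V}

/-- A neighbour `v ≠ j` of `i` with value other than `1` reaches `j` avoiding `i`; prefixing `i`
yields a nontrivial path with second vertex `v`, so `v ∈ I`. -/
theorem sq_commutator_left_le (hij : i ≠ j)
    (hpath : ∀ p : G.toSimpleGraph.Walk i j, p.IsPath → p.length ≠ 1 → p.snd ∈ I)
    (r : ℝ) (v : V) :
    (G.adjMatrix i v * (G.sideFunction i j r v - G.sideFunction i j r i)) ^ 2
      ≤ G.cutWeight i j I J r i v := by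
  have hnn := G.cutWeight_nonneg i j I J r i v
  by_cases h0 : G.adjMatrix i v = 0
  · simpa [h0] using hnn
  rcases eq_or_ne v i with rfl | hvi
  · simpa using hnn
  rcases eq_or_ne v j with rfl | hvj
  · rw [G.sideFunction_left, G.sideFunction_right hij, cutWeight]
    simp only [if_true, if_neg hij]
    have : 0 ≤ if v ∈ I then (1 - r) ^ 2 * G.adjMatrix i v ^ 2 else 0 := by positivity
    linarith
  have hadj := adj_of_adjMatrix_ne_zero hvi.symm h0
  have hvr : G.ReachesAvoiding j i v :=
    (G.reachesAvoiding_target hij.symm).of_adj hvj hadj.symm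
  by_cases hr : G.ReachesAvoiding i j v
  · obtain ⟨p, hp, hl, rfl⟩ := hr.exists_isPath hvj hadj
    rw [G.sideFunction_left, cutWeight, sideFunction, if_neg (not_not.mpr hr),
      if_neg (not_not.mpr hvr)]
    simp only [if_true, if_neg hij, if_neg hvj, if_pos (hpath p hp hl)]
    exact le_of_eq (by ring)
  · rw [G.sideFunction_left, sideFunction, if_pos hr]
    simpa using hnn

theorem sq_commutator_right_le (hij : i ≠ j)
    (hpath : ∀ p : G.toSimpleGraph.Walk i j, p.IsPath → p.length ≠ 1 → p.penultimate ∈ J)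
    (r : ℝ) {v : V} (hvi : v ≠ i) :
    (G.adjMatrix j v * (G.sideFunction i j r v - G.sideFunction i j r j)) ^ 2
      ≤ G.cutWeight i j I J r j v := by
  have hnn := G.cutWeight_nonneg i j I J r j v
  by_cases h0 : G.adjMatrix j v = 0
  · simpa [h0] using hnn
  rcases eq_or_ne v j with rfl | hvj
  · simpa using hnn
  have hadj := adj_of_adjMatrix_ne_zero hvj.symm h0
  have hvr : G.ReachesAvoiding i j v := (G.reachesAvoiding_target hij).of_adj hvi hadj.symm
  by_cases hr : G.ReachesAvoiding j i v
  · obtain ⟨p, hp, hl, rfl⟩ := hr.exists_isPath hvi hadj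
    have hJ : p.snd ∈ J := by
      simpa using hpath p.reverse hp.reverse (by simpa using hl)
    rw [G.sideFunction_right hij, cutWeight, sideFunction, if_neg (not_not.mpr hvr),
      if_neg (not_not.mpr hr)]
    simp only [if_true, if_neg hij.symm, if_pos hJ, G.isSymm.apply]
    exact le_of_eq (by ring)
  · rw [G.sideFunction_right hij, sideFunction, if_neg (not_not.mpr hvr), if_pos hr]
    simpa using hnn

/-- An edge missing both `i` and `j` has endpoints on the same side, so it contributes nothing. -/
theorem sq_commutator_le (hij : i ≠ j)
    (hpath : ∀ p : G.toSimpleGraph.Walk i j, p.IsPath → p.length ≠ 1 →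
      p.snd ∈ I ∧ p.penultimate ∈ J) (r : ℝ) (u v : V) :
    (G.adjMatrix u v * (G.sideFunction i j r v - G.sideFunction i j r u)) ^ 2
      ≤ G.cutWeight i j I J r u v + G.cutWeight i j I J r v u := by
  have hl := sq_commutator_left_le (J := J) hij (fun p hp h => (hpath p hp h).1) r
  have hr := fun v => sq_commutator_right_le (I := I) (v := v) hij
    (fun p hp h => (hpath p hp h).2) r
  have hu := G.cutWeight_nonneg i j I J r u v
  have hv := G.cutWeight_nonneg i j I J r v u
  have hsymm : (G.adjMatrix u v * (G.sideFunction i j r v - G.sideFunction i j r u)) ^ 2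
      = (G.adjMatrix v u * (G.sideFunction i j r u - G.sideFunction i j r v)) ^ 2 := by
    rw [G.isSymm.apply v u]; ring
  rcases eq_or_ne u i with rfl | hui
  · linarith [hl v]
  rcases eq_or_ne v i with rfl | hvi
  · linarith [hl u]
  rcases eq_or_ne u j with rfl | huj
  · linarith [hr v hvi]
  rcases eq_or_ne v j with rfl | hvj
  · linarith [hr u hui]
  by_cases h0 : G.adjMatrix u v = 0
  · simpa [h0] using add_nonneg hu hv
  rcases eq_or_ne u v with rfl | huv
  · simpa using hu
  have hadj := adj_of_adjMatrix_ne_zero huv h0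
  have : G.sideFunction i j r u = G.sideFunction i j r v := by
    have h1 := reachesAvoiding_congr (b := j) hui hvi hadj
    have h2 := reachesAvoiding_congr (b := i) huj hvj hadj
    unfold sideFunction
    split_ifs <;> tauto
  simpa [this] using add_nonneg hu hv

theorem sum_sq_commutator_le [Fintype V] (hij : i ≠ j)
    (hpath : ∀ p : G.toSimpleGraph.Walk i j, p.IsPath → p.length ≠ 1 →
      p.snd ∈ I ∧ p.penultimate ∈ J) (r : ℝ) :
    ∑ u, ∑ v, (G.adjMatrix u v * (G.sideFunction i j r v - G.sideFunction i j r u)) ^ 2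
      ≤ 2 * ((1 - r) ^ 2 * ∑ x ∈ I, G.adjMatrix i x ^ 2 +
        (1 + r) ^ 2 * ∑ y ∈ J, G.adjMatrix y j ^ 2 + 4 * G.adjMatrix i j ^ 2) := by
  calc _ ≤ ∑ u, ∑ v, (G.cutWeight i j I J r u v + G.cutWeight i j I J r v u) :=
        Finset.sum_le_sum fun u _ => Finset.sum_le_sum fun v _ => sq_commutator_le hij hpath r u v
    _ = ∑ u, ∑ v, G.cutWeight i j I J r u v + ∑ u, ∑ v, G.cutWeight i j I J r v u := by
        simp only [Finset.sum_add_distrib]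
    _ = _ := by
        rw [Finset.sum_comm (f := fun u v => G.cutWeight i j I J r v u), sum_cutWeight]; ring

end cut
end WeightedGraph

/-! ### The choice of `r`. -/

/-- Optimising the value given to the vertices between `i` and `j`. -/
theorem exists_weighted_sum_le_two_mul_sqrt {p q : ℝ} (hp : 0 ≤ p) (hq : 0 ≤ q) :
    ∃ r : ℝ, (1 - r) ^ 2 * p + (1 + r) ^ 2 * q ≤ 2 * Real.sqrt (p * q) := by
  obtain ⟨s, hs, rfl⟩ : ∃ s, 0 ≤ s ∧ p = s ^ 2 := ⟨√p, Real.sqrt_nonneg p, (Real.sq_sqrt hp).symm⟩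
  obtain ⟨t, ht, rfl⟩ : ∃ t, 0 ≤ t ∧ q = t ^ 2 := ⟨√q, Real.sqrt_nonneg q, (Real.sq_sqrt hq).symm⟩
  rw [← mul_pow, Real.sqrt_sq (mul_nonneg hs ht)]
  rcases (add_nonneg hs ht).eq_or_lt with h | h
  · obtain rfl : s = 0 := by linarith
    obtain rfl : t = 0 := by linarith
    exact ⟨0, by simp⟩
  -- This `r` makes both terms `4 s² t² / (s + t)²`, and `4 s t ≤ (s + t)²` finishes.
  · refine ⟨(s - t) / (s + t), ?_⟩
    have h1 : 1 - (s - t) / (s + t) = 2 * t / (s + t) := by field_simp; ring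
    have h2 : 1 + (s - t) / (s + t) = 2 * s / (s + t) := by field_simp; ring
    rw [h1, h2, div_pow, div_pow, div_mul_eq_mul_div, div_mul_eq_mul_div, ← add_div,
      div_le_iff₀ (by positivity)]
    nlinarith [mul_nonneg (mul_nonneg hs ht) (sq_nonneg (s - t))]

/-! ### Eigenspaces and strong cospectrality. -/

namespace WeightedGraph

variable {V : Type*} [Fintype V] [DecidableEq V]

/-- The projector is self-adjoint and fixes `w`; relations between projected `e_v` thus become
relations between coordinates of eigenvectors. -/
theorem inner_eigenprojector_single (G : WeightedGraph V) {θ : ℝ} {w : EuclideanSpace ℝ V}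
    (hw : w ∈ G.eigenspace θ) (v : V) :
    inner ℝ w (G.eigenprojector θ (EuclideanSpace.single v 1)) = w v := by
  rw [eigenprojector, ← Submodule.inner_starProjection_left_eq_right,
    Submodule.starProjection_eq_self_iff.mpr hw, EuclideanSpace.inner_single_right]
  simp

theorem mem_eigenvalues_of_mem_eigenspace (G : WeightedGraph V) {θ : ℝ}
    {w : EuclideanSpace ℝ V} (hw : w ∈ G.eigenspace θ) (h0 : w ≠ 0) : θ ∈ G.eigenvalues :=
  Module.End.hasEigenvalue_of_hasEigenvector ⟨hw, h0⟩

theorem mem_eigenvalueSupport_of_apply_ne_zero (G : WeightedGraph V) {θ : ℝ}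
    {w : EuclideanSpace ℝ V} (hw : w ∈ G.eigenspace θ) {v : V} (hv : w v ≠ 0) :
    θ ∈ G.eigenvalueSupport v := by
  refine ⟨G.mem_eigenvalues_of_mem_eigenspace hw ?_, fun h => hv ?_⟩
  · rintro rfl
    exact hv rfl
  · rw [← G.inner_eigenprojector_single hw, h, inner_zero_right]

theorem StronglyCospectral.eigenspace_apply {G : WeightedGraph V} {i j : V}
    (h : G.StronglyCospectral i j) {θ : ℝ} (hθ : θ ∈ G.eigenvalues) :
    (∀ w ∈ G.eigenspace θ, w i = w j) ∨ ∀ w ∈ G.eigenspace θ, w i = -w j := by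
  refine (h θ hθ).imp (fun h w hw => ?_) (fun h w hw => ?_)
  · rw [← G.inner_eigenprojector_single hw, h, G.inner_eigenprojector_single hw]
  · rw [← G.inner_eigenprojector_single hw, h, inner_neg_right, G.inner_eigenprojector_single hw]

theorem StronglyCospectral.mem_eigenvalueSupport {G : WeightedGraph V} {i j : V}
    (h : G.StronglyCospectral i j) {θ : ℝ} {w : EuclideanSpace ℝ V} (hw : w ∈ G.eigenspace θ)
    (hij : w i ≠ 0 ∨ w j ≠ 0) : θ ∈ G.eigenvalueSupport i := by
  have h0 : w ≠ 0 := by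
    rintro rfl
    simp at hij
  refine G.mem_eigenvalueSupport_of_apply_ne_zero hw fun hi => ?_
  rcases h.eigenspace_apply (G.mem_eigenvalues_of_mem_eigenspace hw h0) with h | h <;>
    simp_all

/-- An eigenvalue seen by `e_i + e_j` and one seen by `e_i - e_j` are distinct elements of the
eigenvalue support. -/
theorem StronglyCospectral.ne_of_add_ne_zero_of_sub_ne_zero {G : WeightedGraph V} {i j : V}
    (h : G.StronglyCospectral i j) {θ μ : ℝ} {w z : EuclideanSpace ℝ V}
    (hw : w ∈ G.eigenspace θ) (hz : z ∈ G.eigenspace μ) (hws : w i + w j ≠ 0)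
    (hzd : z i - z j ≠ 0) :
    θ ∈ G.eigenvalueSupport i ∧ μ ∈ G.eigenvalueSupport i ∧ θ ≠ μ := by
  have hθ : θ ∈ G.eigenvalueSupport i := h.mem_eigenvalueSupport hw <| by
    by_contra! h; exact hws (by simp [h])
  refine ⟨hθ, h.mem_eigenvalueSupport hz ?_, ?_⟩
  · by_contra! h; exact hzd (by simp [h])
  · rintro rfl
    rcases h.eigenspace_apply hθ.1 with h | h
    · exact hzd (sub_eq_zero.mpr (h z hz))
    · exact hws (by rw [h w hw]; ring)

theorem finite_eigenvalueSupport (G : WeightedGraph V) (i : V) :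
    (G.eigenvalueSupport i).Finite :=
  (Module.End.finite_hasEigenvalue (Matrix.toEuclideanLin G.adjMatrix)).subset fun _ h => h.1

open Matrix in
/-- An orthogonal matrix whose columns are eigenvectors of the weighted adjacency matrix. -/
theorem exists_orthogonal_diagonalization (G : WeightedGraph V) :
    ∃ (U : Matrix V V ℝ) (l : V → ℝ), U * Uᵀ = 1 ∧ G.adjMatrix * U = U * diagonal l ∧
      ∀ k, WithLp.toLp 2 (fun v => U v k) ∈ G.eigenspace (l k) := by
  have hA : G.adjMatrix.IsHermitian := by
    rw [IsHermitian, conjTranspose_eq_transpose_of_trivial]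
    exact G.isSymm
  refine ⟨hA.eigenvectorUnitary, hA.eigenvalues, ?_, ?_, fun k => ?_⟩
  · have := Unitary.coe_mul_star_self hA.eigenvectorUnitary
    rwa [Unitary.coe_star, star_eq_conjTranspose, conjTranspose_eq_transpose_of_trivial] at this
  · ext v k
    have := congrFun (hA.mulVec_eigenvectorBasis k) v
    rw [mul_diagonal, Matrix.mul_apply]
    simp only [IsHermitian.eigenvectorUnitary_apply]
    simpa [mulVec, dotProduct, mul_comm] using this
  · rw [eigenspace, Module.End.mem_eigenspace_iff]
    ext v
    have := congrFun (hA.mulVec_eigenvectorBasis k) v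
    simpa [Matrix.toLpLin_apply] using this

end WeightedGraph

theorem pairwiseDistances_finite {S : Set ℝ} (hS : S.Finite) : (pairwiseDistances S).Finite := by
  refine (hS.image2 (fun θ μ => |θ - μ|) hS).subset ?_
  rintro d ⟨θ, hθ, μ, hμ, -, rfl⟩
  exact ⟨θ, hθ, μ, hμ, rfl⟩

/-! ### Combining the two bounds. -/

theorem mainTheorem4 {V : Type*} [Fintype V] [DecidableEq V] (G : WeightedGraph V)
    (i j : V) (hij : i ≠ j) (hsc : G.StronglyCospectral i j)
    (I J : Finset V)
    (hI : ∀ x ∈ I, G.toSimpleGraph.Adj i x)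
    (hJ : ∀ y ∈ J, G.toSimpleGraph.Adj y j)
    (hpath : ∀ p : G.toSimpleGraph.Walk i j, p.IsPath → p.length ≠ 1 →
      p.snd ∈ I ∧ p.penultimate ∈ J) :
    ∃ d : ℝ, IsLeast (pairwiseDistances (G.eigenvalueSupport i)) d ∧
      d ≤ |G.adjMatrix i j| +
        Real.sqrt ((G.adjMatrix i j) ^ 2 +
          2 * Real.sqrt ((∑ x ∈ I, (G.adjMatrix i x) ^ 2) *
            (∑ y ∈ J, (G.adjMatrix y j) ^ 2))) := by
  obtain ⟨U, l, hU, hAU, hmem⟩ := G.exists_orthogonal_diagonalization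
  have hdist : ∀ k m, U i k + U j k ≠ 0 → U i m - U j m ≠ 0 →
      |l k - l m| ∈ pairwiseDistances (G.eigenvalueSupport i) := by
    intro k m hk hm
    obtain ⟨h1, h2, h3⟩ := hsc.ne_of_add_ne_zero_of_sub_ne_zero (hmem k) (hmem m) hk hm
    exact ⟨_, h1, _, h2, h3, rfl⟩
  have hUe : ∀ u v, ∑ k, U u k * U v k = (1 : Matrix V V ℝ) u v := by
    intro u v
    rw [← hU, Matrix.mul_apply]; rfl
  -- The cases `c = 1` and `c = -1` supply two distinct elements of the support.
  have hex : ∀ c : ℝ, ∃ k, U i k + c * U j k ≠ 0 := by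
    intro c
    by_contra! h
    have h0 : ∑ k, (U i k + c * U j k) * U i k = 0 :=
      Finset.sum_eq_zero fun k _ => by rw [h k, zero_mul]
    simp only [add_mul, mul_assoc, Finset.sum_add_distrib, ← Finset.mul_sum, hUe] at h0
    rw [Matrix.one_apply_eq, Matrix.one_apply_ne hij.symm] at h0
    norm_num at h0
  obtain ⟨k, hk⟩ := hex 1
  obtain ⟨m, hm⟩ := hex (-1)
  obtain ⟨d, hd, hmin⟩ := Set.exists_min_image _ id
    (pairwiseDistances_finite (G.finite_eigenvalueSupport i))
    ⟨_, hdist k m (by simpa using hk) (by simpa [sub_eq_add_neg] using hm)⟩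
  refine ⟨d, ⟨hd, hmin⟩, ?_⟩
  have hdpos : 0 < d := by
    obtain ⟨θ, -, μ, -, hne, rfl⟩ := hd
    exact abs_pos.mpr (sub_ne_zero.mpr hne)
  obtain ⟨r, hr⟩ := exists_weighted_sum_le_two_mul_sqrt
    (Finset.sum_nonneg fun x (_ : x ∈ I) => sq_nonneg (G.adjMatrix i x))
    (Finset.sum_nonneg fun y (_ : y ∈ J) => sq_nonneg (G.adjMatrix y j))
  have hlow := two_mul_sq_gap_le_sum_sq_commutator hij hU hAU G.isSymm
    (G.sideFunction_left i j r) (G.sideFunction_right hij r) hdpos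
    fun k m hk hm => hmin _ (hdist k m hk hm)
  have hup := WeightedGraph.sum_sq_commutator_le hij hpath r
  set b := 2 * Real.sqrt ((∑ x ∈ I, (G.adjMatrix i x) ^ 2) * (∑ y ∈ J, (G.adjMatrix y j) ^ 2))
    with hb
  have hb0 : 0 ≤ b := by positivity
  have hd2 : d ^ 2 ≤ 4 * G.adjMatrix i j ^ 2 + b := by linarith
  set s := Real.sqrt (G.adjMatrix i j ^ 2 + b) with hs
  have hs0 : 0 ≤ s := Real.sqrt_nonneg _
  have hs2 : s ^ 2 = G.adjMatrix i j ^ 2 + b := Real.sq_sqrt (by positivity)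
  have has : |G.adjMatrix i j| ≤ s := Real.abs_le_sqrt (by linarith)
  have ha2 := sq_abs (G.adjMatrix i j)
  refine le_of_sq_le_sq ?_ (by positivity)
  -- The squared right side is `2 a² + 2 |a| s + b`, at least `4 a² + b` because `|a| ≤ s`.
  nlinarith [mul_le_mul_of_nonneg_left has (abs_nonneg (G.adjMatrix i j))]
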